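/- Let $k$ be a nonnegative integer and let $\Omega\subset\mathbb{R}$ be a nonempty open set. Write $\mathscr{C}^k(\Omega)$ for the set of $k$ times continuously differentiable functions $\Omega\to\mathbb{R}$ (with $\mathscr{C}(\Omega)=\mathscr{C}^0(\Omega)$ the continuous functions). Let $D\colon \mathscr{C}^k(\Omega)\to\mathscr{C}(\Omega)$ be an arbitrary (not necessarily linear) operator such that $$D(fgh)-fD(gh)-gD(fh)-hD(fg)+fgD(h)+fhD(g)+ghD(f)=0\qquad(\ast)$$ for all $f,g,h\in\mathscr{C}^k(\Omega)$, and such that $D$ annihilates (the restrictions to $\Omega$ of) all real polynomials of degree at most $1$. Then there exists a function $c_2\in\mathscr{C}(\Omega)$ such that $$D(f)(x)=c_2(x)f''(x)\qquad (f\in\mathscr{C}^k(\Omega),\ x\in\Omega),$$ where $c_2=0$ if $k\in\{0,1\}$ (in which case the formula is understood as $D=0$). Conversely, let $c_2\in\mathscr{C}(\Omega)$, with $c_2=0$ if $k\in\{0,1\}$. Then $D(f)=c_2f''$ defines an operator $D\colon\mathscr{C}^k(\Omega)\to\mathscr{C}(\Omega)$ that annihilates all polynomials of degree at most $1$ and satisfies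 $(\ast)$ for all $f,g,h\in\mathscr{C}^k(\Omega)$. -/

import Mathlib

/-- The extension by zero to all of `ℝ` of a function `f : Ω → ℝ`. For open `Ω`, the derivatives of
`f` at a point of `Ω` are those of this extension. -/
noncomputable def extendZero {Ω : Set ℝ} (f : Ω → ℝ) : ℝ → ℝ :=
  Function.extend Subtype.val f 0

theorem extendZero_apply {Ω : Set ℝ} (f : Ω → ℝ) (x : Ω) : extendZero f (x : ℝ) = f x :=
  Subtype.val_injective.extend_apply f 0 x

/-- If `F : ℝ → ℝ` is of class `C^k` on `Ω`, so is the extension of its restriction. -/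
theorem contDiffOn_extendZero {k : ℕ} {Ω : Set ℝ} {f : Ω → ℝ} {F : ℝ → ℝ}
    (hF : ContDiffOn ℝ k F Ω) (h : ∀ x : Ω, f x = F x) : ContDiffOn ℝ k (extendZero f) Ω :=
  hF.congr fun x hx => (extendZero_apply f ⟨x, hx⟩).trans (h ⟨x, hx⟩)

/-- `C^k(Ω)`: the algebra, under pointwise operations, of the `k` times continuously
differentiable functions `Ω → ℝ` (for `k = 0`, of the continuous functions). -/
def Ck (k : ℕ) (Ω : Set ℝ) : Subalgebra ℝ (Ω → ℝ) where
  carrier := {f | ContDiffOn ℝ k (extendZero f) Ω}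
  mul_mem' := fun {f g} hf hg => contDiffOn_extendZero
    (F := fun x => extendZero f x * extendZero g x) (ContDiffOn.mul hf hg)
    fun x => by simp [extendZero_apply]
  add_mem' := fun {f g} hf hg => contDiffOn_extendZero
    (F := fun x => extendZero f x + extendZero g x) (ContDiffOn.add hf hg)
    fun x => by simp [extendZero_apply]
  algebraMap_mem' := fun r => contDiffOn_extendZero (F := fun _ => r) contDiffOn_const
    fun x => by simp

/-- The restriction to `Ω` of a real polynomial, as an element of `C^k(Ω)`. -/
def polyCk (k : ℕ) (Ω : Set ℝ) (p : Polynomial ℝ) : Ck k Ω :=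
  ⟨fun x => p.eval (x : ℝ), contDiffOn_extendZero (F := fun x => p.eval x)
    (by simpa using (p.contDiff_aeval (𝕜 := ℝ) k).contDiffOn) fun _ => rfl⟩

/-- The second derivative `f''(x)` of `f : Ω → ℝ` at a point `x` of the open set `Ω`. -/
noncomputable def secondDeriv {Ω : Set ℝ} (f : Ω → ℝ) (x : Ω) : ℝ :=
  iteratedDeriv 2 (extendZero f) x

/-- The operator identity
`D(fgh) - f D(gh) - g D(fh) - h D(fg) + fg D(h) + fh D(g) + gh D(f) = 0` on `C^k(Ω)`;
`D` is an arbitrary map, not assumed to be linear or continuous. -/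
def SatisfiesId2 {k : ℕ} {Ω : Set ℝ} (D : Ck k Ω → C(Ω, ℝ)) : Prop :=
  ∀ (f g h : Ck k Ω) (x : Ω),
    D (f * g * h) x - f.1 x * D (g * h) x - g.1 x * D (f * h) x - h.1 x * D (f * g) x
      + f.1 x * g.1 x * D h x + f.1 x * h.1 x * D g x + g.1 x * h.1 x * D f x = 0

/-- `D` annihilates (the restrictions to `Ω` of) all polynomials of degree at most one. -/
def AnnihilatesDegLEOne {k : ℕ} {Ω : Set ℝ} (D : Ck k Ω → C(Ω, ℝ)) : Prop :=
  ∀ p : Polynomial ℝ, p.natDegree ≤ 1 → D (polyCk k Ω p) = 0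

open Filter Topology Set
open scoped ContDiff

/-! Put B_h(f) = D(fh) - f D(h) - h D(f). The identity (∗) says exactly that B_h obeys the Leibniz
rule in f, and B is symmetric. So everything rests on `IsLeibniz.exists_eq_mul_deriv`: a Leibniz
operator T killing constants is f ↦ b f', without any linearity assumed.

For that, S(u) = e^{-u} T(e^u) is additive and local. Since its values are continuous functions, a
gliding hump makes it real-homogeneous, and one-sided truncation makes S(u)(x) depend only on the
k-jet of u at x; hence S is a differential operator. As T(z - a) has no pole at a, expanding S(log(z
- a)) kills all coefficients of order at least 2, leaving S(u) = b u'.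

Applied to B in each variable, this gives B_h(f) = c f' h'. Then D - (c/2) d²/dx² (just D when k ≤
1, where c = 0) is Leibniz and kills 1 and the identity function, so it is zero. -/

/-! ### Cut-offs, one-sided truncation, small series, additive maps on ℝ -/

theorem exists_bump_of_mem_nhds {x₀ : ℝ} {U : Set ℝ} (hU : U ∈ 𝓝 x₀) :
    ∃ φ : ℝ → ℝ, ContDiff ℝ ∞ φ ∧ φ =ᶠ[𝓝 x₀] 1 ∧ tsupport φ ⊆ U := by
  obtain ⟨r, hr, hrU⟩ := Metric.nhds_basis_closedBall.mem_iff.1 hU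
  let φ : ContDiffBump x₀ := ⟨r / 2, r, half_pos hr, half_lt_self hr⟩
  exact ⟨φ, φ.contDiff, φ.eventuallyEq_one, by rw [φ.tsupport_eq]; exact hrU⟩

theorem contDiff_mul_of_tsupport {n : ℕ∞ω} {φ F : ℝ → ℝ} (hφ : ContDiff ℝ n φ)
    (hF : ∀ x ∈ tsupport φ, ContDiffAt ℝ n F x) : ContDiff ℝ n fun x => φ x * F x := by
  refine contDiff_iff_contDiffAt.2 fun x => ?_
  by_cases hx : x ∈ tsupport φ
  · exact hφ.contDiffAt.mul (hF x hx)
  · refine (contDiffAt_const (c := (0 : ℝ))).congr_of_eventuallyEq ?_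
    filter_upwards [notMem_tsupport_iff_eventuallyEq.1 hx] with y hy
    simp [hy]

theorem ContDiffAt.exists_contDiff_eventuallyEq {k : ℕ} {F : ℝ → ℝ} {x₀ : ℝ}
    (hF : ContDiffAt ℝ k F x₀) : ∃ G : ℝ → ℝ, ContDiff ℝ k G ∧ G =ᶠ[𝓝 x₀] F := by
  obtain ⟨φ, hφ, hφ1, hφU⟩ := exists_bump_of_mem_nhds (hF.eventually (by simp))
  refine ⟨fun x => φ x * F x, contDiff_mul_of_tsupport (hφ.of_le (mod_cast le_top)) hφU, ?_⟩
  filter_upwards [hφ1] with x hx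
  simp [hx]

/-- Truncation commutes with differentiation: at x₀ the truncated function is dominated by F = o(y -
x₀). Induct on k. -/
theorem contDiff_indicator_Ici {k : ℕ} {F : ℝ → ℝ} {x₀ : ℝ} (hF : ContDiff ℝ k F)
    (h : ∀ j ≤ k, iteratedDeriv j F x₀ = 0) : ContDiff ℝ k ((Ici x₀).indicator F) := by
  induction k generalizing F with
  | zero =>
    have h0 : F x₀ = 0 := by simpa using h 0 le_rfl
    simp only [CharP.cast_eq_zero, contDiff_zero] at hF ⊢
    refine hF.indicator fun x hx => ?_
    rw [frontier_Ici, mem_singleton_iff] at hx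
    rw [hx, h0]
  | succ k ih =>
    have h0 : F x₀ = 0 := by simpa using h 0 (by simp)
    have h1 : deriv F x₀ = 0 := by simpa using h 1 (by simp)
    have hd : Differentiable ℝ F := hF.differentiable (by simp)
    have hF' : ContDiff ℝ k (deriv F) := by
      push_cast at hF
      exact (contDiff_succ_iff_deriv.1 hF).2.2
    have key : ∀ x, HasDerivAt ((Ici x₀).indicator F) ((Ici x₀).indicator (deriv F) x) x := by
      intro x
      rcases lt_trichotomy x x₀ with hx | rfl | hx
      · rw [indicator_of_notMem (by simpa using hx)]
        refine (hasDerivAt_const x (0 : ℝ)).congr_of_eventuallyEq ?_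
        filter_upwards [Iio_mem_nhds hx] with y hy
        rw [indicator_of_notMem (by simpa using hy)]
      · rw [indicator_of_mem (by simp), h1]
        have := (hd x).hasDerivAt
        rw [h1, hasDerivAt_iff_isLittleO] at this
        rw [hasDerivAt_iff_isLittleO]
        refine (Asymptotics.IsBigO.of_bound 1 (Eventually.of_forall fun y => ?_)).trans_isLittleO
          this
        by_cases hy : y ∈ Ici x <;> simp [hy, h0]
      · rw [indicator_of_mem (by simpa using hx.le)]
        refine (hd x).hasDerivAt.congr_of_eventuallyEq ?_
        filter_upwards [Ioi_mem_nhds hx] with y hy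
        rw [indicator_of_mem (by simpa using (le_of_lt hy))]
    push_cast
    refine contDiff_succ_iff_deriv.2 ⟨fun x => (key x).differentiableAt, by simp, ?_⟩
    rw [show deriv ((Ici x₀).indicator F) = _ from funext fun x => (key x).deriv]
    refine ih hF' fun j hj => ?_
    rw [← iteratedDeriv_succ']
    exact h _ (by omega)

/-- Compact support bounds the derivatives of w m up to order k by some B m; coefficients below
2^{-m}/(1 + B m) make every differentiated series converge uniformly. -/
theorem exists_contDiff_tsum_of_small {k : ℕ} {w : ℕ → ℝ → ℝ} (hw : ∀ m, ContDiff ℝ k (w m))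
    (hc : ∀ m, HasCompactSupport (w m)) :
    ∃ ε : ℕ → ℝ, (∀ m, 0 < ε m) ∧ ∀ t : ℕ → ℝ, (∀ m, |t m| ≤ ε m) →
      ContDiff ℝ k fun x => ∑' m, t m * w m x := by
  have hb : ∀ m, ∃ B : ℝ, 0 ≤ B ∧ ∀ j ≤ k, ∀ x, ‖iteratedFDeriv ℝ j (w m) x‖ ≤ B := by
    intro m
    have : ∀ j : ℕ, ∃ C : ℝ, j ≤ k → ∀ x, ‖iteratedFDeriv ℝ j (w m) x‖ ≤ C := fun j => by
      by_cases hj : j ≤ k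
      · obtain ⟨C, hC⟩ := ((hc m).iteratedFDeriv j).exists_bound_of_continuous
          ((hw m).continuous_iteratedFDeriv (by exact_mod_cast hj))
        exact ⟨C, fun _ => hC⟩
      · exact ⟨0, fun h => absurd h hj⟩
    choose C hC using this
    refine ⟨∑ j ∈ Finset.range (k + 1), |C j|, Finset.sum_nonneg fun _ _ => abs_nonneg _,
      fun j hj x => (hC j hj x).trans ((le_abs_self _).trans ?_)⟩
    exact Finset.single_le_sum (f := fun j => |C j|) (fun _ _ => abs_nonneg _)
      (Finset.mem_range.2 (by omega))
  choose B hB0 hB using hb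
  refine ⟨fun m => (1 / 2) ^ m / (1 + B m), fun m => ?_, fun t ht => ?_⟩
  · have := hB0 m
    positivity
  · have := contDiff_tsum (𝕜 := ℝ) (N := (k : ℕ∞)) (f := fun m x => t m * w m x)
      (v := fun _ m => (1 / 2 : ℝ) ^ m) (fun m => contDiff_const.mul (hw m))
      (fun _ _ => summable_geometric_two) ?_
    · exact this
    · intro j m x hj
      have hj' : j ≤ k := by exact_mod_cast hj
      have h1 : iteratedFDeriv ℝ j (fun x => t m * w m x) x
          = t m • iteratedFDeriv ℝ j (w m) x :=
        iteratedFDeriv_const_smul_apply (a := t m) (f := w m)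
          ((hw m).of_le (by exact_mod_cast hj')).contDiffAt
      rw [h1, norm_smul, Real.norm_eq_abs]
      have h2 := hB m j hj' x
      have h3 := hB0 m
      calc |t m| * ‖iteratedFDeriv ℝ j (w m) x‖ ≤ ((1 / 2) ^ m / (1 + B m)) * (1 + B m) := by
            gcongr
            · exact ht m
            · linarith
        _ = (1 / 2) ^ m := by field_simp

/-- An additive map bounded by 1 on [-ε, ε] is bounded by 1/n on [-ε/n, ε/n], hence continuous,
hence linear. -/
theorem AddMonoidHom.exists_one_lt_abs_of_not_linear {A : ℝ →+ ℝ} {t : ℝ} (h : A t ≠ t * A 1)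
    {ε : ℝ} (hε : 0 < ε) : ∃ s, |s| ≤ ε ∧ 1 < |A s| := by
  by_contra! hA
  refine h ?_
  have hc : Continuous A := by
    refine continuous_of_continuousAt_zero A ?_
    rw [Metric.continuousAt_iff]
    intro δ hδ
    obtain ⟨n, hn⟩ := exists_nat_gt (1 / δ)
    have hn0 : (0 : ℝ) < n := lt_trans (by positivity) hn
    refine ⟨ε / n, by positivity, fun {s} hs => ?_⟩
    simp only [dist_zero_right, map_zero, Real.norm_eq_abs] at hs ⊢
    have h1 := hA (n • s) (by
      rw [nsmul_eq_mul, abs_mul, Nat.abs_cast]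
      rw [lt_div_iff₀ hn0] at hs
      linarith)
    rw [map_nsmul, nsmul_eq_mul, abs_mul, Nat.abs_cast] at h1
    rw [div_lt_iff₀ hδ] at hn
    by_contra! hcon
    nlinarith
  simpa using map_real_smul A hc t 1

/-! ### Locality of operators on C^k(Ω) -/

variable {k : ℕ} {Ω : Set ℝ}

/-- The restriction to `Ω` of a `C^k` function on `ℝ`. -/
def resCk (k : ℕ) (Ω : Set ℝ) (F : ℝ → ℝ) (hF : ContDiff ℝ k F) : Ck k Ω :=
  ⟨fun x => F x, contDiffOn_extendZero hF.contDiffOn fun _ => rfl⟩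

theorem resCk_apply {F : ℝ → ℝ} (hF : ContDiff ℝ k F) (x : Ω) : (resCk k Ω F hF).1 x = F x := rfl

/-- The value of `T f` at a point depends only on the germ of `f` at that point. -/
def IsLocalOp (T : Ck k Ω → C(Ω, ℝ)) : Prop :=
  ∀ (f g : Ck k Ω) (x : Ω), f.1 =ᶠ[𝓝 x] g.1 → T f x = T g x

/-- The Leibniz rule `T(fg) = f T(g) + g T(f)`. -/
def IsLeibniz (T : Ck k Ω → C(Ω, ℝ)) : Prop :=
  ∀ (f g : Ck k Ω) (x : Ω), T (f * g) x = f.1 x * T g x + g.1 x * T f x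

/-- `T` annihilates the constants. -/
def KillsConst (T : Ck k Ω → C(Ω, ℝ)) : Prop :=
  ∀ c : ℝ, T (algebraMap ℝ (Ck k Ω) c) = 0

theorem mul_val_apply (f g : Ck k Ω) (x : Ω) : (f * g).1 x = f.1 x * g.1 x := rfl
theorem add_val_apply (f g : Ck k Ω) (x : Ω) : (f + g).1 x = f.1 x + g.1 x := rfl
theorem smul_val_apply (c : ℝ) (f : Ck k Ω) (x : Ω) : (c • f).1 x = c * f.1 x := rfl
theorem algebraMap_val_apply (c : ℝ) (x : Ω) : (algebraMap ℝ (Ck k Ω) c).1 x = c := rfl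

theorem eventually_subtype_of_nhds {p : ℝ → Prop} {x : Ω} (h : ∀ᶠ y in 𝓝 (x : ℝ), p y) :
    ∀ᶠ y : Ω in 𝓝 x, p y :=
  continuous_subtype_val.continuousAt.eventually h

theorem eventually_nhds_of_subtype (hΩ : IsOpen Ω) {p : ℝ → Prop} {x : Ω}
    (h : ∀ᶠ y : Ω in 𝓝 x, p y) : ∀ᶠ y in 𝓝 (x : ℝ), p y := by
  rw [← hΩ.isOpenEmbedding_subtypeVal.map_nhds_eq]
  exact h

theorem extendZero_eventuallyEq (hΩ : IsOpen Ω) {f : Ω → ℝ} {F : ℝ → ℝ} {x : Ω}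
    (h : ∀ᶠ y : Ω in 𝓝 x, f y = F y) : extendZero f =ᶠ[𝓝 (x : ℝ)] F := by
  refine eventually_nhds_of_subtype hΩ ?_
  filter_upwards [h] with y hy
  rw [extendZero_apply, hy]

theorem Ck.contDiffAt (hΩ : IsOpen Ω) (f : Ck k Ω) (x : Ω) :
    ContDiffAt ℝ k (extendZero f.1) x :=
  f.2.contDiffAt (hΩ.mem_nhds x.2)

theorem Ck.continuous (f : Ck k Ω) : Continuous f.1 := by
  have h : ContDiffOn ℝ k (extendZero f.1) Ω := f.2
  have := continuousOn_iff_continuous_domRestrict.1 h.continuousOn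
  convert this using 1
  ext x
  exact (extendZero_apply f.1 x).symm

theorem exists_resCk_eventuallyEq (hΩ : IsOpen Ω) (f : Ck k Ω) (x : Ω) :
    ∃ (F : ℝ → ℝ) (hF : ContDiff ℝ k F), F =ᶠ[𝓝 (x : ℝ)] extendZero f.1 ∧
      (resCk k Ω F hF).1 =ᶠ[𝓝 x] f.1 := by
  obtain ⟨F, hF, h⟩ := (Ck.contDiffAt hΩ f x).exists_contDiff_eventuallyEq
  refine ⟨F, hF, h, ?_⟩
  filter_upwards [eventually_subtype_of_nhds h] with y hy
  rw [resCk_apply, hy, extendZero_apply]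

theorem exists_resCk_of_contDiffAt {F : ℝ → ℝ} {x : Ω} (hF : ContDiffAt ℝ k F (x : ℝ)) :
    ∃ u : Ck k Ω, ∀ᶠ y : Ω in 𝓝 x, u.1 y = F y := by
  obtain ⟨G, hG, h⟩ := hF.exists_contDiff_eventuallyEq
  exact ⟨resCk k Ω G hG, eventually_subtype_of_nhds h⟩

/-- Turns equality of germs into equality of products, to which the product identities apply. -/
theorem exists_mul_eq_mul {f g : Ck k Ω} {x : Ω} (hΩ : IsOpen Ω) (h : f.1 =ᶠ[𝓝 x] g.1) :
    ∃ φ : Ck k Ω, φ.1 x = 1 ∧ f * φ = g * φ := by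
  have hU : {y | extendZero f.1 y = extendZero g.1 y} ∈ 𝓝 (x : ℝ) := by
    refine eventually_nhds_of_subtype hΩ ?_
    filter_upwards [h] with y hy
    rw [extendZero_apply, extendZero_apply, hy]
  obtain ⟨φ, hφ, hφ1, hφU⟩ := exists_bump_of_mem_nhds hU
  refine ⟨resCk k Ω φ (hφ.of_le (mod_cast le_top)), hφ1.self_of_nhds, ?_⟩
  refine Subtype.ext (funext fun y => ?_)
  rw [mul_val_apply, mul_val_apply, resCk_apply]
  by_cases hy : φ y = 0
  · simp [hy]
  · have := hφU (subset_tsupport φ hy)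
    simp only [mem_ofPred_eq, extendZero_apply] at this
    rw [this]

theorem IsLeibniz.isLocalOp (hΩ : IsOpen Ω) {T : Ck k Ω → C(Ω, ℝ)} (hT : IsLeibniz T) :
    IsLocalOp T := by
  intro f g x h
  obtain ⟨φ, hφ1, hφ⟩ := exists_mul_eq_mul hΩ h
  have h1 := hT f φ x
  rw [hφ, hT g φ x, hφ1, h.self_of_nhds] at h1
  linarith

/-- In (∗) with both other arguments φ, every term at x depends only on fφ, φ and f(x), except
D(f)(x), whose coefficient is φ(x)² = 1. -/
theorem SatisfiesId2.isLocalOp (hΩ : IsOpen Ω) {D : Ck k Ω → C(Ω, ℝ)} (hD : SatisfiesId2 D) :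
    IsLocalOp D := by
  intro f g x h
  obtain ⟨φ, hφ1, hφ⟩ := exists_mul_eq_mul hΩ h
  have h1 := hD f φ φ x
  have h2 := hD g φ φ x
  rw [hφ, hφ1, h.self_of_nhds] at h1
  rw [hφ1] at h2
  linarith

/-! ### The additive operator attached to a Leibniz operator -/

/-- The exponential of a `C^k` function. -/
noncomputable def expCk (u : Ck k Ω) : Ck k Ω :=
  ⟨fun x => Real.exp (u.1 x), contDiffOn_extendZero (F := fun x => Real.exp (extendZero u.1 x))
    (ContDiffOn.exp u.2) fun x => by rw [extendZero_apply]⟩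

theorem expCk_apply (u : Ck k Ω) (x : Ω) : (expCk u).1 x = Real.exp (u.1 x) := rfl

theorem expCk_add (u v : Ck k Ω) : expCk (u + v) = expCk u * expCk v :=
  Subtype.ext (funext fun x => Real.exp_add (u.1 x) (v.1 x))

/-- The additive operator `u ↦ e^{-u} T(e^u)` attached to an operator satisfying the Leibniz rule. -/
noncomputable def logOp (T : Ck k Ω → C(Ω, ℝ)) (hT : IsLeibniz T) : Ck k Ω →+ C(Ω, ℝ) :=
  AddMonoidHom.mk' (fun u => ⟨fun x => Real.exp (-u.1 x) * T (expCk u) x,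
      (Real.continuous_exp.comp (Ck.continuous u).neg).mul (T (expCk u)).continuous⟩) fun u v => by
    ext x
    simp only [ContinuousMap.coe_mk, ContinuousMap.add_apply]
    rw [expCk_add, hT, add_val_apply, expCk_apply, expCk_apply, neg_add, Real.exp_add,
      Real.exp_neg, Real.exp_neg]
    have h1 := (Real.exp_pos (u.1 x)).ne'
    have h2 := (Real.exp_pos (v.1 x)).ne'
    field_simp
    ring

theorem logOp_apply {T : Ck k Ω → C(Ω, ℝ)} (hT : IsLeibniz T) (u : Ck k Ω) (x : Ω) :
    logOp T hT u x = Real.exp (-u.1 x) * T (expCk u) x := rfl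

theorem apply_expCk {T : Ck k Ω → C(Ω, ℝ)} (hT : IsLeibniz T) (u : Ck k Ω) (x : Ω) :
    T (expCk u) x = Real.exp (u.1 x) * logOp T hT u x := by
  rw [logOp_apply, ← mul_assoc, ← Real.exp_add]
  simp

theorem isLocalOp_logOp {T : Ck k Ω → C(Ω, ℝ)} (hT : IsLeibniz T) (hl : IsLocalOp T) :
    IsLocalOp (logOp T hT) := by
  intro u v x h
  rw [logOp_apply, logOp_apply, h.self_of_nhds, hl (expCk u) (expCk v) x]
  filter_upwards [h] with y hy
  rw [expCk_apply, expCk_apply, hy]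

theorem killsConst_logOp {T : Ck k Ω → C(Ω, ℝ)} (hT : IsLeibniz T) (hc : KillsConst T) :
    KillsConst (logOp T hT) := by
  intro c
  ext x
  have : expCk (algebraMap ℝ (Ck k Ω) c) = algebraMap ℝ (Ck k Ω) (Real.exp c) :=
    Subtype.ext (funext fun y => rfl)
  rw [logOp_apply, this, hc]
  simp

/-! ### Additive local operators are differential operators -/

/-- Continuity of the images extends locality to boundary points of s; this is what permits
one-sided arguments. -/
theorem IsLocalOp.apply_eq_of_eqOn {T : Ck k Ω → C(Ω, ℝ)} (hT : IsLocalOp T) (hΩ : IsOpen Ω)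
    {f g : Ck k Ω} {s : Set ℝ} (hs : IsOpen s) (h : ∀ x : Ω, (x : ℝ) ∈ s → f.1 x = g.1 x) {y : Ω}
    (hy : (y : ℝ) ∈ closure s) : T f y = T g y := by
  have hcl : y ∈ closure (Subtype.val ⁻¹' s : Set Ω) :=
    hΩ.isOpenEmbedding_subtypeVal.isOpenMap.preimage_closure_subset_closure_preimage hy
  refine closure_minimal (t := {x | T f x = T g x}) (fun x hx => hT f g x ?_)
    (isClosed_eq (T f).continuous (T g).continuous) hcl
  filter_upwards [eventually_subtype_of_nhds (hs.mem_nhds hx)] with z hz using h z hz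

/-- Gliding hump: failure at y persists at points y + q m → y, where s ↦ S(s u) is additive but not
linear, so exceeds 1 for arbitrarily small s. Gluing such small multiples of u gives W of class C^k
with S(W)(y) = 0 but |S(W)(y + q m)| > 1, contradicting continuity. -/
theorem map_smul_of_isLocalOp (hΩ : IsOpen Ω) {S : Ck k Ω →+ C(Ω, ℝ)} (hS : IsLocalOp S)
    (t : ℝ) (u : Ck k Ω) : S (t • u) = t • S u := by
  ext y
  by_contra hne
  -- the set where homogeneity fails contains an interval
  have hbad : ∀ᶠ x : Ω in 𝓝 y, S (t • u) x ≠ t * S u x :=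
    (isOpen_ne_fun (S (t • u)).continuous ((S u).continuous.const_mul t)).mem_nhds hne
  have hbad' : ∀ᶠ z in 𝓝 (y : ℝ), ∃ h : z ∈ Ω, S (t • u) ⟨z, h⟩ ≠ t * S u ⟨z, h⟩ := by
    refine eventually_nhds_of_subtype hΩ ?_
    filter_upwards [hbad] with z hz using ⟨z.2, hz⟩
  obtain ⟨r, hr, hrb⟩ := Metric.eventually_nhds_iff.1 hbad'
  have hlt : ∀ z : ℝ, |z - y| < r → ∃ h : z ∈ Ω, S (t • u) ⟨z, h⟩ ≠ t * S u ⟨z, h⟩ :=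
    fun z hz => hrb (by rwa [Real.dist_eq])
  set q : ℕ → ℝ := fun m => r / 4 * (1 / 2) ^ m with hq
  have hq0 : ∀ m, 0 < q m := fun m => by positivity
  have hq1 : ∀ m, q m ≤ r / 4 := fun m => by
    have : (1 / 2 : ℝ) ^ m ≤ 1 := pow_le_one₀ (by norm_num) (by norm_num)
    simp only [hq]; nlinarith
  have hqlim : Tendsto q atTop (𝓝 0) := by
    simpa [hq] using (tendsto_pow_atTop_nhds_zero_of_lt_one (r := (1 / 2 : ℝ)) (by norm_num)
      (by norm_num)).const_mul (r / 4)
  have hqs : ∀ m n, m < n → q n ≤ q m / 2 := fun m n hmn => by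
    have : (1 / 2 : ℝ) ^ n ≤ (1 / 2) ^ (m + 1) :=
      pow_le_pow_of_le_one (by norm_num) (by norm_num) hmn
    simp only [hq]
    rw [pow_succ] at this
    nlinarith
  choose hmem hfail using fun m => hlt (y + q m) (by
    rw [add_sub_cancel_left, abs_of_pos (hq0 m)]; linarith [hq1 m])
  -- localised copies of `u`
  let ψ : ∀ m, ContDiffBump ((y : ℝ) + q m) := fun m =>
    ⟨q m / 8, q m / 4, by linarith [hq0 m], by linarith [hq0 m]⟩
  have hψc : ∀ m, HasCompactSupport (ψ m) := fun m => (ψ m).hasCompactSupport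
  have hψ0 : ∀ m z, q m / 4 ≤ |z - (y + q m)| → ψ m z = 0 := fun m z hz =>
    (ψ m).zero_of_le_dist (by rwa [Real.dist_eq])
  obtain ⟨ε, hε, hsum⟩ := exists_contDiff_tsum_of_small (k := k)
    (w := fun m x => ψ m x * extendZero u.1 x)
    (fun m => contDiff_mul_of_tsupport (ψ m).contDiff fun x hx => by
      rw [(ψ m).tsupport_eq, Metric.mem_closedBall, Real.dist_eq] at hx
      have hx' : |x - (y + q m)| ≤ q m / 4 := hx
      obtain ⟨hxΩ, -⟩ := hlt x (by
        rw [abs_le] at hx'; rw [abs_lt]; constructor <;> linarith [hq0 m, hq1 m])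
      exact Ck.contDiffAt hΩ u ⟨x, hxΩ⟩)
    (fun m => (hψc m).mul_right)
  have hex : ∀ m, ∃ s, |s| ≤ ε m ∧ 1 < |S (s • u) ⟨y + q m, hmem m⟩| := fun m => by
    let A : ℝ →+ ℝ := AddMonoidHom.mk' (fun s => S (s • u) ⟨y + q m, hmem m⟩) fun a b => by
      rw [add_smul, map_add]; rfl
    refine AddMonoidHom.exists_one_lt_abs_of_not_linear (A := A) (t := t) ?_ (hε m)
    simpa [A] using hfail m
  choose s hs hs1 using hex
  set W : ℝ → ℝ := fun x => ∑' m, s m * (ψ m x * extendZero u.1 x)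
  have hW : ContDiff ℝ k W := hsum s hs
  have hWy : S (resCk k Ω W hW) y = 0 := by
    suffices h : S (resCk k Ω W hW) y = S 0 y by rw [h, map_zero]; rfl
    refine hS.apply_eq_of_eqOn hΩ isOpen_Iio (fun x hx => ?_)
      (by rw [closure_Iio]; exact self_mem_Iic : (y : ℝ) ∈ closure (Iio (y : ℝ)))
    rw [mem_Iio] at hx
    rw [resCk_apply]
    have : ∀ m, s m * (ψ m x * extendZero u.1 x) = 0 := fun m => by
      rw [hψ0 m x]
      · simp
      · rw [abs_sub_comm, le_abs]; left; linarith [hq0 m]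
    simp only [W, this, tsum_zero]
    rfl
  have hWm : ∀ m, S (resCk k Ω W hW) ⟨y + q m, hmem m⟩ = S (s m • u) ⟨y + q m, hmem m⟩ :=
    fun m => by
    refine hS _ _ _ ?_
    filter_upwards [eventually_subtype_of_nhds (Ω := Ω) (x := ⟨y + q m, hmem m⟩)
      (Metric.ball_mem_nhds ((y : ℝ) + q m) (show 0 < q m / 8 by linarith [hq0 m]))] with z hz
    rw [Real.dist_eq] at hz
    rw [resCk_apply, smul_val_apply]
    have h1 : ψ m z = 1 := (ψ m).one_of_mem_closedBall (by
      rw [Metric.mem_closedBall, Real.dist_eq]; exact hz.le)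
    have h2 : ∀ n, n ≠ m → s n * (ψ n z * extendZero u.1 z) = 0 := fun n hn => by
      rw [hψ0 n z]
      · simp
      · rw [abs_lt] at hz
        rcases lt_or_gt_of_ne hn with h | h
        · have := hqs n m h
          rw [abs_sub_comm, le_abs]; left; linarith [hq0 n, hq0 m]
        · have := hqs m n h
          rw [le_abs]; left; linarith [hq0 n, hq0 m]
    simp only [W]
    rw [tsum_eq_single m h2, h1, extendZero_apply, one_mul]
  have hlim : Tendsto (fun m => (⟨y + q m, hmem m⟩ : Ω)) atTop (𝓝 y) := by
    rw [tendsto_subtype_rng]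
    simpa using hqlim.const_add (y : ℝ)
  have hlim2 := (((S (resCk k Ω W hW)).continuous.tendsto y).comp hlim).abs
  rw [hWy, abs_zero] at hlim2
  obtain ⟨m, hm⟩ := (hlim2.eventually (gt_mem_nhds zero_lt_one)).exists
  simp only [Function.comp_apply, hWm] at hm
  exact lt_asymm hm (hs1 m)

/-- The truncation of F to [x, ∞) agrees with F on the right of x and with 0 on the left, so both
have the same image at x. -/
theorem IsLocalOp.apply_eq_zero_of_jet {S : Ck k Ω →+ C(Ω, ℝ)} (hS : IsLocalOp S)
    (hΩ : IsOpen Ω) {F : ℝ → ℝ} (hF : ContDiff ℝ k F) {x : Ω}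
    (h : ∀ j ≤ k, iteratedDeriv j F x = 0) : S (resCk k Ω F hF) x = 0 := by
  have hG := contDiff_indicator_Ici hF h
  have h1 : S (resCk k Ω F hF) x = S (resCk k Ω _ hG) x :=
    hS.apply_eq_of_eqOn hΩ isOpen_Ioi (fun y hy => by
      rw [resCk_apply, resCk_apply, indicator_of_mem (by simpa using (le_of_lt hy))])
      (by rw [closure_Ioi]; exact self_mem_Ici : (x : ℝ) ∈ closure (Ioi (x : ℝ)))
  have h2 : S (resCk k Ω _ hG) x = S 0 x :=
    hS.apply_eq_of_eqOn hΩ isOpen_Iio (fun y hy => by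
      rw [resCk_apply, indicator_of_notMem (by simpa using hy)]; rfl)
      (by rw [closure_Iio]; exact self_mem_Iic : (x : ℝ) ∈ closure (Iio (x : ℝ)))
  rw [h1, h2, map_zero]
  rfl

/-- The monomial `(z - a)^j` as an element of `C^k(Ω)`. -/
def powCk (k : ℕ) (Ω : Set ℝ) (a : ℝ) (j : ℕ) : Ck k Ω :=
  resCk k Ω (fun z => (z - a) ^ j) ((contDiff_id.sub contDiff_const).pow j)

theorem powCk_apply (a : ℝ) (j : ℕ) (x : Ω) : (powCk k Ω a j).1 x = ((x : ℝ) - a) ^ j := rfl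

theorem powCk_zero (a : ℝ) : powCk k Ω a 0 = algebraMap ℝ (Ck k Ω) 1 :=
  Subtype.ext (funext fun x => by simp [powCk_apply])

theorem sum_val_apply {ι : Type*} (s : Finset ι) (f : ι → Ck k Ω) (x : Ω) :
    (∑ i ∈ s, f i).1 x = ∑ i ∈ s, (f i).1 x := by
  have : (∑ i ∈ s, f i).1 = ∑ i ∈ s, (f i).1 := by push_cast; rfl
  rw [this, Finset.sum_apply]

/-- Subtracting the Taylor polynomial leaves a function with zero k-jet, which S kills at x. -/
theorem IsLocalOp.apply_eq_sum {S : Ck k Ω →+ C(Ω, ℝ)} (hS : IsLocalOp S) (hΩ : IsOpen Ω)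
    (u : Ck k Ω) (x : Ω) :
    S u x = ∑ j ∈ Finset.range (k + 1),
      iteratedDeriv j (extendZero u.1) x / j.factorial * S (powCk k Ω x j) x := by
  obtain ⟨F, hF, hFu, hu⟩ := exists_resCk_eventuallyEq hΩ u x
  rw [← hS _ _ x hu]
  set a : ℕ → ℝ := fun j => iteratedDeriv j (extendZero u.1) x with ha
  have hterm : ∀ j ∈ Finset.range (k + 1),
      ContDiff ℝ k fun z : ℝ => a j / j.factorial * (z - x) ^ j := fun j _ =>
    contDiff_const.mul ((contDiff_id.sub contDiff_const).pow j)
  have hP : ContDiff ℝ k fun z : ℝ => ∑ j ∈ Finset.range (k + 1),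
      a j / j.factorial * (z - x) ^ j := ContDiff.sum hterm
  have hder : ∀ i ≤ k, iteratedDeriv i (fun z : ℝ => ∑ j ∈ Finset.range (k + 1),
      a j / j.factorial * (z - x) ^ j) x = a i := by
    intro i hi
    rw [iteratedDeriv_fun_sum fun j hj =>
      ((hterm j hj).of_le (by exact_mod_cast hi)).contDiffAt]
    have : ∀ j, iteratedDeriv i (fun z : ℝ => a j / j.factorial * (z - x) ^ j) x
        = if i = j then a i else 0 := by
      intro j
      rw [iteratedDeriv_const_mul_field, iteratedDeriv_comp_sub_const i (fun z : ℝ => z ^ j)]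
      simp only [sub_self, iteratedDeriv_fun_pow_zero]
      split_ifs with hij
      · subst hij
        have := Nat.cast_ne_zero (R := ℝ).2 i.factorial_ne_zero
        field_simp
      · simp
    simp only [this]
    rw [Finset.sum_ite_eq, if_pos (Finset.mem_range.2 (by omega))]
  have hjet := hS.apply_eq_zero_of_jet hΩ (hF.sub hP) (x := x) fun j hj => by
    have hj' : (j : ℕ∞ω) ≤ k := by exact_mod_cast hj
    rw [show (fun y => F y - ∑ j ∈ Finset.range (k + 1), a j / j.factorial * (y - x) ^ j)
      = F - fun y : ℝ => ∑ j ∈ Finset.range (k + 1), a j / j.factorial * (y - x) ^ j from rfl,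
      iteratedDeriv_sub (hF.of_le hj').contDiffAt (hP.of_le hj').contDiffAt, hder j hj,
      hFu.iteratedDeriv_eq, sub_self]
  have hdec : resCk k Ω F hF = resCk k Ω _ (hF.sub hP)
      + ∑ j ∈ Finset.range (k + 1), (a j / j.factorial) • powCk k Ω x j := by
    refine Subtype.ext (funext fun y => ?_)
    rw [add_val_apply, sum_val_apply]
    simp only [smul_val_apply, powCk_apply, resCk_apply]
    ring
  rw [hdec, map_add, map_sum, ContinuousMap.add_apply, hjet, zero_add, ContinuousMap.coe_sum,
    Finset.sum_apply]
  refine Finset.sum_congr rfl fun j _ => ?_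
  rw [map_smul_of_isLocalOp hΩ hS]
  rfl

/-- The argument of S moves with x; expanding (z - x)^j about 0 leaves finitely many fixed
arguments. -/
theorem IsLocalOp.continuous_apply_powCk {S : Ck k Ω →+ C(Ω, ℝ)} (hS : IsLocalOp S)
    (hΩ : IsOpen Ω) (j : ℕ) : Continuous fun x : Ω => S (powCk k Ω x j) x := by
  have h : ∀ a : ℝ, powCk k Ω a j
      = ∑ i ∈ Finset.range (j + 1), ((-a) ^ (j - i) * j.choose i) • powCk k Ω 0 i := by
    intro a
    refine Subtype.ext (funext fun y => ?_)
    rw [sum_val_apply]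
    simp only [smul_val_apply, powCk_apply, sub_zero]
    rw [sub_eq_add_neg, add_pow]
    exact Finset.sum_congr rfl fun i _ => by ring
  have h2 : (fun x : Ω => S (powCk k Ω x j) x) = fun x : Ω => ∑ i ∈ Finset.range (j + 1),
      ((-(x : ℝ)) ^ (j - i) * j.choose i) * S (powCk k Ω 0 i) x := by
    funext x
    rw [h, map_sum, ContinuousMap.coe_sum, Finset.sum_apply]
    refine Finset.sum_congr rfl fun i _ => ?_
    rw [map_smul_of_isLocalOp hΩ hS]
    rfl
  rw [h2]
  exact continuous_finsetSum _ fun i _ => by fun_prop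

/-! ### Classification of Leibniz operators -/

theorem iteratedDeriv_succ_log_sub (j : ℕ) (a x : ℝ) :
    iteratedDeriv (j + 1) (fun z => Real.log (z - a)) x
      = (-1) ^ j * j.factorial * ((x - a) ^ (j + 1))⁻¹ := by
  rw [iteratedDeriv_comp_sub_const (j + 1) Real.log, iteratedDeriv_succ', Real.deriv_log',
    iteratedDeriv_eq_iterate]
  beta_reduce
  rw [iter_deriv_inv, show (-1 - (j : ℤ)) = -((j + 1 : ℕ) : ℤ) by push_cast; ring, zpow_neg, zpow_natCast]

/-- Expand S at u = log(z - a), where e^u = z - a, and multiply by (x - a)^(d - 1). As x → a from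
the right the left side vanishes since d ≥ 2, while only the term j = d survives on the right. -/
theorem logOp_powCk_eq_zero_of_forall_gt {T : Ck k Ω → C(Ω, ℝ)} (hT : IsLeibniz T)
    (hc : KillsConst T) (hΩ : IsOpen Ω) {d : ℕ} (hd : 2 ≤ d) (hdk : d ≤ k)
    (h : ∀ j, d < j → j ≤ k → ∀ x : Ω, logOp T hT (powCk k Ω x j) x = 0) (a : Ω) :
    logOp T hT (powCk k Ω a d) a = 0 := by
  have hl := hT.isLocalOp hΩ
  have hS := isLocalOp_logOp hT hl
  have hS1 := killsConst_logOp hT hc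
  set S := logOp T hT with hSdef
  -- The truncated subtractions j - 1 at j = 0, and d - j for j > d below, are harmless: those terms
  -- carry a zero coefficient of S.
  set b : ℕ → ℝ := fun j => (-1) ^ (j - 1) * (j - 1).factorial / j.factorial with hb
  have hlog : ∀ x : Ω, (a : ℝ) < x → ((x : ℝ) - a) ^ (d - 1) * T (powCk k Ω a 1) x
      = ∑ j ∈ Finset.range (k + 1), b j * (((x : ℝ) - a) ^ (d - j)) * S (powCk k Ω x j) x := by
    intro x hx
    have hxa : (0 : ℝ) < x - a := sub_pos.2 hx
    obtain ⟨u, hu⟩ := exists_resCk_of_contDiffAt (k := k) (F := fun z => Real.log (z - a)) (x := x)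
      ((contDiffAt_id.sub contDiffAt_const).log hxa.ne')
    have hTu : T (powCk k Ω a 1) x = T (expCk u) x := by
      refine hl _ _ _ ?_
      filter_upwards [hu, eventually_subtype_of_nhds (Ioi_mem_nhds hx)] with y hy hya
      rw [expCk_apply, hy, Real.exp_log (sub_pos.2 hya), powCk_apply, pow_one]
    rw [hTu, apply_expCk hT, hu.self_of_nhds, Real.exp_log hxa, ← hSdef,
      hS.apply_eq_sum hΩ, ← mul_assoc, ← pow_succ, Nat.sub_add_cancel (by omega), Finset.mul_sum]
    refine Finset.sum_congr rfl fun j hj => ?_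
    rw [(extendZero_eventuallyEq (F := fun z => Real.log (z - a)) hΩ hu).iteratedDeriv_eq]
    have hjk : j ≤ k := by have := Finset.mem_range.1 hj; omega
    rcases j with _ | j
    · rw [powCk_zero, hS1]; simp
    rcases lt_or_ge d (j + 1) with hj | hj
    · rw [h _ hj hjk]; simp
    · rw [iteratedDeriv_succ_log_sub]
      obtain ⟨e, rfl⟩ := Nat.exists_eq_add_of_le hj
      simp only [hb, Nat.add_sub_cancel_left, Nat.add_sub_cancel, pow_add]
      field_simp
  have hcl : a ∈ closure (Subtype.val ⁻¹' Ioi (a : ℝ) : Set Ω) :=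
    hΩ.isOpenEmbedding_subtypeVal.isOpenMap.preimage_closure_subset_closure_preimage
      (by rw [closure_Ioi]; exact self_mem_Ici : (a : ℝ) ∈ closure (Ioi (a : ℝ)))
  have hcont : ∀ j, Continuous fun x : Ω => S (powCk k Ω x j) x :=
    hS.continuous_apply_powCk hΩ
  have ha := closure_minimal (t := {x : Ω | ((x : ℝ) - a) ^ (d - 1) * T (powCk k Ω a 1) x
      = ∑ j ∈ Finset.range (k + 1), b j * (((x : ℝ) - a) ^ (d - j)) * S (powCk k Ω x j) x})
    (fun x hx => hlog x hx)
    (isClosed_eq (by fun_prop) (continuous_finsetSum _ fun j _ =>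
      (by fun_prop : Continuous fun x : Ω => b j * (((x : ℝ) - a) ^ (d - j))).mul (hcont j))) hcl
  simp only [mem_ofPred_eq, sub_self] at ha
  rw [zero_pow (by omega), zero_mul, Finset.sum_eq_single d] at ha
  · have hbd : b d ≠ 0 := by
      have h1 := Nat.cast_ne_zero (R := ℝ).2 d.factorial_ne_zero
      have h2 := Nat.cast_ne_zero (R := ℝ).2 (d - 1).factorial_ne_zero
      simp only [hb]
      positivity
    simpa [hbd] using ha.symm
  · intro j hj hjd
    rcases lt_or_gt_of_ne hjd with hlt | hgt
    · rw [zero_pow (by omega)]; simp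
    · rw [h j hgt (by have := Finset.mem_range.1 hj; omega)]; simp
  · intro hd'
    exact absurd (Finset.mem_range.2 (by omega)) hd'

theorem logOp_powCk_eq_zero {T : Ck k Ω → C(Ω, ℝ)} (hT : IsLeibniz T)
    (hc : KillsConst T) (hΩ : IsOpen Ω) {d : ℕ} (hd : 2 ≤ d) (hdk : d ≤ k) (a : Ω) :
    logOp T hT (powCk k Ω a d) a = 0 := by
  induction hn : k - d using Nat.strong_induction_on generalizing d a with
  | _ n ih =>
    exact logOp_powCk_eq_zero_of_forall_gt hT hc hΩ hd hdk
      (fun j hj hjk x => ih (k - j) (by omega) (by omega) hjk x rfl) a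

theorem logOp_apply_eq {T : Ck k Ω → C(Ω, ℝ)} (hT : IsLeibniz T)
    (hc : KillsConst T) (hΩ : IsOpen Ω) : ∃ b : C(Ω, ℝ), (k = 0 → b = 0) ∧
      ∀ u x, logOp T hT u x = b x * deriv (extendZero u.1) x := by
  have hS := isLocalOp_logOp hT (hT.isLocalOp hΩ)
  have hS0 : ∀ x : Ω, logOp T hT (powCk k Ω x 0) x = 0 := fun x => by
    rw [powCk_zero, killsConst_logOp hT hc]; rfl
  rcases Nat.eq_zero_or_pos k with hk | hk
  · refine ⟨0, fun _ => rfl, fun u x => ?_⟩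
    rw [hS.apply_eq_sum hΩ, Finset.sum_eq_single 0]
    · rw [hS0]; simp
    · intro j hj hj0
      have := Finset.mem_range.1 hj
      omega
    · simp
  · refine ⟨⟨_, hS.continuous_apply_powCk hΩ 1⟩, fun h => by omega, fun u x => ?_⟩
    rw [hS.apply_eq_sum hΩ, Finset.sum_eq_single 1]
    · simp [mul_comm]
    · intro j hj hj1
      rcases j with _ | j
      · rw [hS0]; simp
      · rw [logOp_powCk_eq_zero hT hc hΩ (by omega) (by have := Finset.mem_range.1 hj; omega)]
        simp
    · intro h
      exact absurd (Finset.mem_range.2 (by omega)) h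

theorem Ck.continuous_deriv (hΩ : IsOpen Ω) (hk : 1 ≤ k) (f : Ck k Ω) :
    Continuous fun x : Ω => deriv (extendZero f.1) x := by
  have h : ContDiffOn ℝ k (extendZero f.1) Ω := f.2
  exact continuousOn_iff_continuous_domRestrict.1
    (h.continuousOn_deriv_of_isOpen hΩ (by exact_mod_cast hk))

/-- An operator `C^k(Ω) → C(Ω)` that satisfies the Leibniz rule and annihilates the constants is a
continuous multiple of the derivative. -/
theorem IsLeibniz.exists_eq_mul_deriv {T : Ck k Ω → C(Ω, ℝ)} (hT : IsLeibniz T)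
    (hc : KillsConst T) (hΩ : IsOpen Ω) : ∃ b : C(Ω, ℝ), (k = 0 → b = 0) ∧
      ∀ f x, T f x = b x * deriv (extendZero f.1) x := by
  obtain ⟨b, hb0, hb⟩ := logOp_apply_eq hT hc hΩ
  have hl := hT.isLocalOp hΩ
  refine ⟨b, hb0, fun f x => ?_⟩
  have hne : ∀ y : Ω, f.1 y ≠ 0 → T f y = b y * deriv (extendZero f.1) y := by
    intro y hy
    have hy' : extendZero f.1 y ≠ 0 := by rwa [extendZero_apply]
    obtain ⟨u, hu⟩ := exists_resCk_of_contDiffAt ((Ck.contDiffAt hΩ f y).log hy')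
    -- Near y, f = s e^u with s = ±1 and u = log |f|; then b u' = b f'/f yields the formula.
    obtain ⟨s, hs⟩ : ∃ s : ℝ, ∀ᶠ z : Ω in 𝓝 y, f.1 z = s * |f.1 z| := by
      rcases lt_or_gt_of_ne hy with h | h
      · refine ⟨-1, ?_⟩
        filter_upwards [(Ck.continuous f).continuousAt.eventually (gt_mem_nhds h)] with z hz
        rw [abs_of_neg hz]; ring
      · refine ⟨1, ?_⟩
        filter_upwards [(Ck.continuous f).continuousAt.eventually (lt_mem_nhds h)] with z hz
        rw [abs_of_pos hz]; ring
    have hexp : ∀ᶠ z : Ω in 𝓝 y, f.1 z = s * Real.exp (u.1 z) := by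
      filter_upwards [hs, hu, (Ck.continuous f).continuousAt.eventually_ne hy] with z h1 h2 h3
      rw [h2, extendZero_apply, Real.exp_log_eq_abs h3, ← h1]
    have hT1 : T f y = T (algebraMap ℝ (Ck k Ω) s * expCk u) y := hl _ _ _ hexp
    rw [hT1, hT, hc, algebraMap_val_apply, apply_expCk hT, hb,
      (extendZero_eventuallyEq (F := fun z => Real.log (extendZero f.1 z)) hΩ hu).deriv_eq]
    rcases Nat.eq_zero_or_pos k with hk | hk
    · simp [hb0 hk]
    · have hd : DifferentiableAt ℝ (extendZero f.1) y :=
        (Ck.contDiffAt hΩ f y).differentiableAt (by exact_mod_cast hk.ne')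
      rw [deriv.log hd hy', extendZero_apply]
      simp only [ContinuousMap.zero_apply, mul_zero, add_zero]
      have hfy := hexp.self_of_nhds
      field_simp
      rw [hfy]
      ring
  by_cases hx : x ∈ closure {y : Ω | f.1 y ≠ 0}
  · refine closure_minimal (t := {y : Ω | T f y = b y * deriv (extendZero f.1) y}) hne ?_ hx
    rcases Nat.eq_zero_or_pos k with hk | hk
    · simp only [hb0 hk, ContinuousMap.zero_apply, zero_mul]
      exact isClosed_eq (T f).continuous continuous_const
    · exact isClosed_eq (T f).continuous (b.continuous.mul (Ck.continuous_deriv hΩ hk f))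
  -- Off the closure of {f ≠ 0}, f has the germ of the constant 0.
  · have hf0 : ∀ᶠ y : Ω in 𝓝 x, f.1 y = 0 := by
      rw [mem_closure_iff_frequently] at hx
      filter_upwards [not_frequently.1 hx] with y hy
      simpa using hy
    have hT0 : T f x = T (algebraMap ℝ (Ck k Ω) 0) x := hl _ _ _ hf0
    rw [hT0, hc, (extendZero_eventuallyEq (F := fun _ => 0) hΩ hf0).deriv_eq]
    simp

/-! ### The operator c f'' and the converse -/

theorem extendZero_mul_eventuallyEq (hΩ : IsOpen Ω) (f g : Ck k Ω) (x : Ω) :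
    extendZero (f * g).1 =ᶠ[𝓝 (x : ℝ)] extendZero f.1 * extendZero g.1 :=
  extendZero_eventuallyEq hΩ (Eventually.of_forall fun y => by
    rw [mul_val_apply, Pi.mul_apply, extendZero_apply, extendZero_apply])

theorem deriv_extendZero_mul (hΩ : IsOpen Ω) (hk : 1 ≤ k) (f g : Ck k Ω) (x : Ω) :
    deriv (extendZero (f * g).1) x
      = deriv (extendZero f.1) x * g.1 x + f.1 x * deriv (extendZero g.1) x := by
  have hk0 : (k : ℕ∞ω) ≠ 0 := by exact_mod_cast (by omega : k ≠ 0)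
  rw [(extendZero_mul_eventuallyEq hΩ f g x).deriv_eq,
    deriv_mul ((Ck.contDiffAt hΩ f x).differentiableAt hk0)
      ((Ck.contDiffAt hΩ g x).differentiableAt hk0), extendZero_apply, extendZero_apply]

theorem secondDeriv_mul (hΩ : IsOpen Ω) (hk : 2 ≤ k) (f g : Ck k Ω) (x : Ω) :
    secondDeriv (f * g).1 x = secondDeriv f.1 x * g.1 x
      + 2 * deriv (extendZero f.1) x * deriv (extendZero g.1) x
      + f.1 x * secondDeriv g.1 x := by
  have hk2 : ((2 : ℕ) : ℕ∞ω) ≤ k := by exact_mod_cast hk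
  unfold secondDeriv
  rw [(extendZero_mul_eventuallyEq hΩ f g x).iteratedDeriv_eq,
    iteratedDeriv_mul ((Ck.contDiffAt hΩ f x).of_le hk2) ((Ck.contDiffAt hΩ g x).of_le hk2)]
  simp [Finset.sum_range_succ, extendZero_apply]
  ring

/-- For k ≤ 1, `secondDeriv` may be a default value; the factor c = 0 removes it. -/
theorem continuous_mul_secondDeriv (hΩ : IsOpen Ω) {c : C(Ω, ℝ)} (hc : k = 0 ∨ k = 1 → c = 0)
    (f : Ck k Ω) : Continuous fun x => c x * secondDeriv f.1 x := by
  by_cases hk : k = 0 ∨ k = 1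
  · simp only [hc hk, ContinuousMap.zero_apply, zero_mul]
    exact continuous_const
  · refine c.continuous.mul ?_
    have hk2 : ((2 : ℕ) : ℕ∞ω) ≤ k := by exact_mod_cast (by omega : 2 ≤ k)
    refine continuous_iff_continuousAt.2 fun x => ?_
    have h := ((Ck.contDiffAt hΩ f x).of_le hk2)
    have h2 : ContinuousAt (iteratedDeriv 2 (extendZero f.1)) x := by
      rw [iteratedDeriv_eq_equiv_comp]
      exact (LinearIsometryEquiv.continuous _).continuousAt.comp
        (h.continuousAt_iteratedFDeriv le_rfl)
    exact h2.comp continuous_subtype_val.continuousAt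

/-- The operator `f ↦ c f''`. -/
noncomputable def mulSecondDeriv (hΩ : IsOpen Ω) (c : C(Ω, ℝ)) (hc : k = 0 ∨ k = 1 → c = 0) :
    Ck k Ω → C(Ω, ℝ) :=
  fun f => ⟨fun x => c x * secondDeriv f.1 x, continuous_mul_secondDeriv hΩ hc f⟩

theorem secondDeriv_polyCk (hΩ : IsOpen Ω) {p : Polynomial ℝ} (hp : p.natDegree ≤ 1) (x : Ω) :
    secondDeriv (polyCk k Ω p).1 x = 0 := by
  obtain ⟨a, b, rfl⟩ := Polynomial.exists_eq_X_add_C_of_natDegree_le_one hp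
  unfold secondDeriv
  rw [(extendZero_eventuallyEq (F := fun z => a * z + b) hΩ (Eventually.of_forall fun y => by
    simp [polyCk])).iteratedDeriv_eq]
  simp [iteratedDeriv_succ']

theorem satisfiesId2_of_eq_mul_secondDeriv (hΩ : IsOpen Ω) {c : C(Ω, ℝ)}
    (hc : k = 0 ∨ k = 1 → c = 0) {D : Ck k Ω → C(Ω, ℝ)}
    (hD : ∀ f x, D f x = c x * secondDeriv f.1 x) : SatisfiesId2 D := by
  intro f g h x
  by_cases hk : k = 0 ∨ k = 1
  · simp [hD, hc hk]
  · simp only [hD, secondDeriv_mul hΩ (by omega : 2 ≤ k),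
      deriv_extendZero_mul hΩ (by omega : 1 ≤ k), mul_val_apply]
    ring

/-! ### The Leibniz defect as a symmetric biderivation -/

/-- The deviation `D(fh) - f D(h) - h D(f)` of `D` from the Leibniz rule. -/
def leibnizDefect (D : Ck k Ω → C(Ω, ℝ)) (h f : Ck k Ω) : C(Ω, ℝ) :=
  ⟨fun x => D (f * h) x - f.1 x * D h x - h.1 x * D f x, by
    have := Ck.continuous f
    have := Ck.continuous h
    fun_prop⟩

theorem leibnizDefect_apply (D : Ck k Ω → C(Ω, ℝ)) (h f : Ck k Ω) (x : Ω) :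
    leibnizDefect D h f x = D (f * h) x - f.1 x * D h x - h.1 x * D f x := rfl

theorem leibnizDefect_comm (D : Ck k Ω → C(Ω, ℝ)) (h f : Ck k Ω) :
    leibnizDefect D h f = leibnizDefect D f h := by
  ext x
  rw [leibnizDefect_apply, leibnizDefect_apply, mul_comm f h]
  ring

theorem SatisfiesId2.isLeibniz_leibnizDefect {D : Ck k Ω → C(Ω, ℝ)} (hD : SatisfiesId2 D)
    (h : Ck k Ω) : IsLeibniz (leibnizDefect D h) := by
  intro f g x
  have := hD f g h x
  simp only [leibnizDefect_apply, mul_val_apply]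
  linarith

theorem AnnihilatesDegLEOne.apply_linear {D : Ck k Ω → C(Ω, ℝ)} (hA : AnnihilatesDegLEOne D)
    {f : Ck k Ω} (a b : ℝ) (hf : ∀ x : Ω, f.1 x = a * x + b) : D f = 0 := by
  rw [← hA (Polynomial.C a * Polynomial.X + Polynomial.C b) Polynomial.natDegree_linear_le]
  congr 1
  exact Subtype.ext (funext fun x => by rw [hf]; simp [polyCk])

theorem AnnihilatesDegLEOne.killsConst {D : Ck k Ω → C(Ω, ℝ)} (hA : AnnihilatesDegLEOne D) :
    KillsConst D :=
  fun c => hA.apply_linear 0 c fun x => by rw [algebraMap_val_apply]; ring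

theorem deriv_extendZero_powCk_one (hΩ : IsOpen Ω) (a : ℝ) (x : Ω) :
    deriv (extendZero (powCk k Ω a 1).1) x = 1 := by
  rw [(extendZero_eventuallyEq (F := fun z => z - a) hΩ (Eventually.of_forall fun y => by
    rw [powCk_apply, pow_one])).deriv_eq]
  simp

theorem IsLeibniz.eq_zero_of_apply_id {T : Ck k Ω → C(Ω, ℝ)} (hT : IsLeibniz T)
    (hc : KillsConst T) (hΩ : IsOpen Ω) (hX : T (powCk k Ω 0 1) = 0) (f : Ck k Ω) : T f = 0 := by
  obtain ⟨b, -, hb⟩ := hT.exists_eq_mul_deriv hc hΩ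
  have hb0 : ∀ x, b x = 0 := fun x => by
    have := hb (powCk k Ω 0 1) x
    rw [hX, deriv_extendZero_powCk_one hΩ, mul_one] at this
    exact this.symm
  ext x
  rw [hb, hb0, zero_mul]
  rfl

/-- By symmetry B_h(e) = B_e(h), and B_e is Leibniz and kills constants and the identity function,
as D kills degree at most 1. -/
theorem SatisfiesId2.killsConst_leibnizDefect {D : Ck k Ω → C(Ω, ℝ)} (hD : SatisfiesId2 D)
    (hA : AnnihilatesDegLEOne D) (hΩ : IsOpen Ω) (h : Ck k Ω) :
    KillsConst (leibnizDefect D h) := by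
  intro e
  rw [leibnizDefect_comm]
  refine (hD.isLeibniz_leibnizDefect _).eq_zero_of_apply_id (fun c => ?_) hΩ ?_ h
  · ext x
    rw [leibnizDefect_apply, ← map_mul, hA.killsConst, hA.killsConst, hA.killsConst]
    simp
  · ext x
    rw [leibnizDefect_apply, hA.killsConst, hA.apply_linear (f := powCk k Ω 0 1) 1 0,
      hA.apply_linear (f := powCk k Ω 0 1 * _) e 0]
    · simp
    · intro y
      rw [mul_val_apply, powCk_apply, algebraMap_val_apply]
      ring
    · intro y
      rw [powCk_apply]
      ring

/-- B_h(f) = b f' with b = B_h(id) = B_id(h) = c h'. -/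
theorem SatisfiesId2.exists_leibnizDefect_eq {D : Ck k Ω → C(Ω, ℝ)} (hD : SatisfiesId2 D)
    (hA : AnnihilatesDegLEOne D) (hΩ : IsOpen Ω) : ∃ c : C(Ω, ℝ), (k = 0 → c = 0) ∧
      ∀ h f x, leibnizDefect D h f x
        = c x * deriv (extendZero f.1) x * deriv (extendZero h.1) x := by
  have key := fun h => (hD.isLeibniz_leibnizDefect h).exists_eq_mul_deriv
    (hD.killsConst_leibnizDefect hA hΩ h) hΩ
  obtain ⟨c, hc0, hc⟩ := key (powCk k Ω 0 1)
  refine ⟨c, hc0, fun h f x => ?_⟩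
  obtain ⟨b, -, hb⟩ := key h
  have h1 := hb (powCk k Ω 0 1) x
  rw [deriv_extendZero_powCk_one hΩ, leibnizDefect_comm, hc, mul_one] at h1
  rw [hb, ← h1]
  ring

/-- For k ≤ 1 the truncation of (z - a)² to [a, ∞) is still C^k, so locality from both sides gives
D((z - a)²)(a) = 0; this number is c(a). -/
theorem coeff_eq_zero_of_le_one {D : Ck k Ω → C(Ω, ℝ)} (hD : SatisfiesId2 D)
    (hA : AnnihilatesDegLEOne D) (hΩ : IsOpen Ω) (hk : k ≤ 1) {c : C(Ω, ℝ)}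
    (hc : ∀ h f x, leibnizDefect D h f x
        = c x * deriv (extendZero f.1) x * deriv (extendZero h.1) x) : c = 0 := by
  ext a
  have hl := hD.isLocalOp hΩ
  have hF : ContDiff ℝ k fun z : ℝ => (z - (a : ℝ)) ^ 2 :=
    (contDiff_id.sub contDiff_const).pow 2
  have hG := contDiff_indicator_Ici hF (x₀ := a) fun j hj => by
    rw [iteratedDeriv_comp_sub_const j (fun z : ℝ => z ^ 2)]
    simp only [sub_self, iteratedDeriv_fun_pow_zero]
    rw [if_neg (by omega), Nat.cast_zero]
  have hright : D (resCk k Ω _ hG) a = D (powCk k Ω a 1 * powCk k Ω a 1) a :=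
    hl.apply_eq_of_eqOn hΩ isOpen_Ioi (fun y hy => by
      rw [resCk_apply, indicator_of_mem (by simpa using (le_of_lt hy)), mul_val_apply,
        powCk_apply]
      ring)
      (by rw [closure_Ioi]; exact self_mem_Ici : (a : ℝ) ∈ closure (Ioi (a : ℝ)))
  have hleft : D (resCk k Ω _ hG) a = D (algebraMap ℝ (Ck k Ω) 0) a :=
    hl.apply_eq_of_eqOn hΩ isOpen_Iio (fun y hy => by
      rw [resCk_apply, indicator_of_notMem (by simpa using hy), algebraMap_val_apply])
      (by rw [closure_Iio]; exact self_mem_Iic : (a : ℝ) ∈ closure (Iio (a : ℝ)))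
  have h := hc (powCk k Ω a 1) (powCk k Ω a 1) a
  rw [leibnizDefect_apply, ← hright, hleft, hA.killsConst, deriv_extendZero_powCk_one hΩ,
    hA.apply_linear (f := powCk k Ω a 1) 1 (-a) fun y => by rw [powCk_apply]; ring] at h
  simpa using h.symm

theorem SatisfiesId2.exists_eq_mul_secondDeriv {D : Ck k Ω → C(Ω, ℝ)} (hD : SatisfiesId2 D)
    (hA : AnnihilatesDegLEOne D) (hΩ : IsOpen Ω) : ∃ c : C(Ω, ℝ),
      (∀ f x, D f x = c x * secondDeriv f.1 x) ∧ (k = 0 ∨ k = 1 → c = 0) := by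
  obtain ⟨c, -, hc⟩ := hD.exists_leibnizDefect_eq hA hΩ
  have hc0 : k = 0 ∨ k = 1 → (1 / 2 : ℝ) • c = 0 := fun hk => by
    rw [coeff_eq_zero_of_le_one hD hA hΩ (by omega) hc, smul_zero]
  -- The factor 1/2 cancels the 2 in the cross term 2f'g' of (fg)'', so M and D have the same
  -- defect.
  set M := mulSecondDeriv hΩ ((1 / 2 : ℝ) • c) hc0
  have hM : ∀ f x, M f x = (1 / 2 * c x) * secondDeriv f.1 x := fun f x => rfl
  have hlin : ∀ (f : Ck k Ω) (a b : ℝ), (∀ x : Ω, f.1 x = a * x + b) → M f = 0 := by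
    intro f a b hf
    have hMA : AnnihilatesDegLEOne M := fun p hp => by
      ext x
      rw [hM, secondDeriv_polyCk hΩ hp, mul_zero]
      rfl
    exact hMA.apply_linear a b hf
  have hE : IsLeibniz fun f => D f - M f := by
    intro f g x
    have h := hc g f x
    rw [leibnizDefect_apply] at h
    simp only [ContinuousMap.sub_apply, hM]
    by_cases hk : k = 0 ∨ k = 1
    · have hcx : c x = 0 := by
        rw [coeff_eq_zero_of_le_one hD hA hΩ (by omega) hc]; rfl
      rw [hcx] at h ⊢
      linarith
    · rw [secondDeriv_mul hΩ (by omega)]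
      linarith
  refine ⟨_, fun f x => ?_, hc0⟩
  have h0 := hE.eq_zero_of_apply_id (fun e => ?_) hΩ ?_ f
  · have := congrArg (fun F : C(Ω, ℝ) => F x) h0
    exact sub_eq_zero.1 this
  · simp only
    rw [hA.killsConst, hlin _ 0 e fun x => by rw [algebraMap_val_apply]; ring, sub_zero]
  · have hX : ∀ x : Ω, (powCk k Ω 0 1).1 x = 1 * x + 0 := fun x => by rw [powCk_apply]; ring
    rw [hA.apply_linear 1 0 hX, hlin _ 1 0 hX, sub_zero]

theorem mainTheorem5 (k : ℕ) (Ω : Set ℝ) (hΩ : IsOpen Ω) (hne : Ω.Nonempty) :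
    (∀ D : Ck k Ω → C(Ω, ℝ), SatisfiesId2 D → AnnihilatesDegLEOne D →
      ∃ c₂ : C(Ω, ℝ),
        (∀ (f : Ck k Ω) (x : Ω), D f x = c₂ x * secondDeriv f.1 x) ∧
        (k = 0 ∨ k = 1 → c₂ = 0)) ∧
    (∀ c₂ : C(Ω, ℝ), (k = 0 ∨ k = 1 → c₂ = 0) →
      (∃ D : Ck k Ω → C(Ω, ℝ),
        ∀ (f : Ck k Ω) (x : Ω), D f x = c₂ x * secondDeriv f.1 x) ∧
      (∀ D : Ck k Ω → C(Ω, ℝ),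
        (∀ (f : Ck k Ω) (x : Ω), D f x = c₂ x * secondDeriv f.1 x) →
          AnnihilatesDegLEOne D ∧ SatisfiesId2 D)) := by
  refine ⟨fun D hD hA => hD.exists_eq_mul_secondDeriv hA hΩ, fun c₂ hc => ⟨⟨mulSecondDeriv hΩ c₂ hc,
    fun f x => rfl⟩, fun D hD => ⟨fun p hp => ?_, satisfiesId2_of_eq_mul_secondDeriv hΩ hc hD⟩⟩⟩
  ext x
  rw [hD, secondDeriv_polyCk hΩ hp, mul_zero]
  rfl
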